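/- Let $d\ge 1$ and $\lambda>0$, let $\mathbf N$ be the space of locally finite subsets of $\mathbb R^d$ (with the $\sigma$-algebra generated by the counts $Y\mapsto \#(Y\cap A)$, $A$ bounded Borel), and let $B^d$ be the closed unit ball of $\mathbb R^d$. Let $X$ be a stationary Poisson point process in $\mathbb R^d$ of intensity $\lambda$ and, for each integer $m\ge 1$, let $X^+=X^+_m$ be a stationary Poisson point process in $\mathbb R^d$ of intensity $\lambda(1+\frac1m)$. Let $S:\mathbf N\to\mathbb R$ be measurable. Suppose that $R:\mathbf N\to\mathbb R$ and $f:\mathbb R\to\mathbb R$ are such that $R(X)$ is a radius of influence of $S(X)$ with bound $f$; that is, for almost every realization $Y$ of $X$: (A1) $S(Y)=S(Y\cup D^\circ)$ for every locally finite $D^\circ\subset\mathbb R^d\setminus R(Y)B^d$; (A2) $|S(Y)-S(Y\cup D)|\le f(R(Y))$ for every locally finite $D\subset\mathbb R^d$. If $\mathbb E\big(f(R(X))^2R(X)^{2d}\big)$ exists and is finite, then $$\operatorname{Var} S(X)\;\le\;\liminf_{m\to\infty}\ \mathbb E\sum_{x\in X^+_m}\big(S(X^+_m\setminus\{x\})-S(X^+_m)\big)^2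 ,$$ as an inequality in $[0,\infty]$, where $\operatorname{Var}S(X)=\infty$ if $S(X)$ is not square integrable. In particular, $\operatorname{Var}S(X)$ is bounded by the limit of the right-hand expectations whenever that limit exists. -/

import Mathlib

open MeasureTheory ProbabilityTheory Filter

/-- A locally finite subset of `ℝ^d`: it has finitely many points in every bounded set. -/
@[ext]
structure PointConfig (d : ℕ) where
  /-- the underlying set of points -/
  carrier : Set (EuclideanSpace ℝ (Fin d))
  finite_inter : ∀ B : Set (EuclideanSpace ℝ (Fin d)), Bornology.IsBounded B →
    (carrier ∩ B).Finite

namespace PointConfig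

variable {d : ℕ}

/-- The number of points of `Y` in `A` (used only for bounded `A`, where it is finite). -/
noncomputable def count (A : Set (EuclideanSpace ℝ (Fin d))) (Y : PointConfig d) : ℕ :=
  (Y.carrier ∩ A).ncard

/-- The usual σ-algebra on the space of locally finite sets, generated by the counts
`Y ↦ #(Y ∩ A)` for bounded Borel sets `A`. -/
noncomputable instance instMeasurableSpace : MeasurableSpace (PointConfig d) :=
  ⨆ (A : Set (EuclideanSpace ℝ (Fin d))) (_ : MeasurableSet A) (_ : Bornology.IsBounded A),
    MeasurableSpace.comap (count A) ⊤

/-- The union `Y ∪ D` of two locally finite sets. -/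
instance instUnion : Union (PointConfig d) where
  union Y D :=
    { carrier := Y.carrier ∪ D.carrier
      finite_inter := fun B hB => by
        rw [Set.union_inter_distrib_right]
        exact (Y.finite_inter B hB).union (D.finite_inter B hB) }

/-- The set `Y ∖ {x}`. -/
def remove (Y : PointConfig d) (x : EuclideanSpace ℝ (Fin d)) : PointConfig d where
  carrier := Y.carrier \ {x}
  finite_inter := fun B hB =>
    (Y.finite_inter B hB).subset (Set.inter_subset_inter_left B Set.sdiff_subset)

end PointConfig

/-- `X` is a (stationary) Poisson point process in `ℝ^d` of intensity `lam`: a random locally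
finite set such that the number of points in a bounded Borel set `A` is Poisson distributed
with parameter `lam * vol A`, and the numbers of points in pairwise disjoint bounded Borel sets
are independent. -/
structure IsPoissonProcess {d : ℕ} {Ω : Type*} [MeasurableSpace Ω] (P : Measure Ω)
    (X : Ω → PointConfig d) (lam : ℝ) : Prop where
  measurable : Measurable X
  map_count : ∀ A : Set (EuclideanSpace ℝ (Fin d)), MeasurableSet A → Bornology.IsBounded A →
    P.map (fun ω => (X ω).count A) = poissonMeasure (lam * volume.real A).toNNReal
  indep_count : ∀ (n : ℕ) (A : Fin n → Set (EuclideanSpace ℝ (Fin d))),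
    (∀ i, MeasurableSet (A i)) → (∀ i, Bornology.IsBounded (A i)) →
    Pairwise (fun i j => Disjoint (A i) (A j)) →
    iIndepFun (fun i ω => (X ω).count (A i)) P

open scoped Pointwise in
/-- The number `r` is a radius of influence of the functional `S` at `Y`, with bound function
`f`: points added outside the ball `r B^d` do not change `S`, and no added points whatsoever
change `S` by more than `f r`. -/
def IsRadiusOfInfluence {d : ℕ} (S : PointConfig d → ℝ) (f : ℝ → ℝ) (Y : PointConfig d)
    (r : ℝ) : Prop :=
  (∀ D : PointConfig d,
    D.carrier ⊆ (r • Metric.closedBall (0 : EuclideanSpace ℝ (Fin d)) 1)ᶜ → S Y = S (Y ∪ D)) ∧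
  (∀ D : PointConfig d, |S Y - S (Y ∪ D)| ≤ f r)

/-- The jackknife sum `∑_{x ∈ Y} (S (Y ∖ {x}) - S Y)^2`, with values in `[0, ∞]`. -/
noncomputable def jackknifeSum {d : ℕ} (S : PointConfig d → ℝ) (Y : PointConfig d) : ENNReal :=
  ∑' x : Y.carrier, ENNReal.ofReal ((S (Y.remove x) - S Y) ^ 2)

/-!
The inequality follows from the Poincaré inequality for the Poisson process,
`Var S(X) ≤ E ∑_{x ∈ X} (S(X ∖ {x}) - S(X))²`, applied to each process `X'_m`, together with the
convergence of `S(X'_m)` to `S(X)` in law.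

*Poincaré inequality* (`variance_le_lintegral_jackknifeSum`, for bounded `S`). Resampling a Poisson
process outside a Borel set `A` does not change its law. Averaging `S` over this resampling is
therefore an orthogonal projection in `L²`, namely the conditional expectation given the
configuration in `A`, and the projections for `A` and `B` compose to the one for `A ∩ B`. This gives
the Efron–Stein inequality: with `V(A)` the mean square error of the projection for `A`,
`V(A ∩ B) ≤ V(A) + V(B)`, while `V(∅)` is the variance. A large ball `W` has `V(W)` small, by Lévy's
upward theorem. If `W` is cut into cells `C` of small volume, then
`V(∅) ≤ V(W) + ∑_C V(Cᶜ)` and `V(Cᶜ) ≤ E (S(X) - S(X ∖ C))²`. A cell without points contributes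
nothing, a cell with exactly one point `x` contributes the term of `x` in the jackknife sum, and
cells with two or more points have total probability of order `∑_C vol(C)²`, which is negligible.

*Convergence in law* (`tendsto_integral_of_radius`). `X'_m` has the law of `X ∪ D_m`, where `D_m` is
an independent Poisson process of intensity `λ / m`; dilating an independent copy of `X` by the
factor `m^{1/d}` produces such a `D_m`. Given `X`, the process `D_m` misses the ball of radius
`R(X)` with probability tending to one, and then `S(X ∪ D_m) = S(X)`. Identifying laws requires that the
intensity determines the law of a Poisson process (`HasPoissonLaw.map_eq`).

*Truncation* (`evariance_le_of_truncate`). Truncating `S` to `[-n, n]` preserves the radius of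
influence and does not increase the jackknife sum. The variance of `S(X)` is half the mean square
difference of two independent copies, so Fatou's lemma passes the bound from the truncations to `S`.
-/

/-! ### Locally finite configurations: counts, restriction, resampling, dilation -/

namespace PointConfig

variable {d : ℕ}

theorem count_eq_zero_iff {A : Set (EuclideanSpace ℝ (Fin d))} (hA : Bornology.IsBounded A)
    (Y : PointConfig d) : count A Y = 0 ↔ Disjoint Y.carrier A := by
  rw [count, Set.ncard_eq_zero (Y.finite_inter A hA), Set.disjoint_iff_inter_eq_empty]

theorem measurable_count {A : Set (EuclideanSpace ℝ (Fin d))} (hA : MeasurableSet A)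
    (hb : Bornology.IsBounded A) : Measurable (count A) := by
  rw [measurable_iff_comap_le]
  exact le_iSup_of_le A (le_iSup_of_le hA (le_iSup_of_le hb le_rfl))

theorem measurable_counts {α : Type*} [MeasurableSpace α] {X : α → PointConfig d}
    (hX : Measurable X) {ι : Type*}
    {A : ι → Set (EuclideanSpace ℝ (Fin d))}
    (hA : ∀ i, MeasurableSet (A i)) (hb : ∀ i, Bornology.IsBounded (A i)) :
    Measurable fun ω i => (X ω).count (A i) :=
  measurable_pi_lambda _ fun i => (measurable_count (hA i) (hb i)).comp hX

theorem measurable_of_count {α : Type*} {m : MeasurableSpace α} {X : α → PointConfig d}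
    (h : ∀ A : Set (EuclideanSpace ℝ (Fin d)), MeasurableSet A → Bornology.IsBounded A →
      Measurable fun a => count A (X a)) : Measurable X := by
  rw [measurable_iff_comap_le, instMeasurableSpace]
  simp only [MeasurableSpace.comap_iSup, MeasurableSpace.comap_comp]
  exact iSup_le fun A => iSup_le fun hA => iSup_le fun hb => (h A hA hb).comap_le

theorem count_congr {A B : Set (EuclideanSpace ℝ (Fin d))} {Y Z : PointConfig d}
    (h : Y.carrier ∩ A = Z.carrier ∩ B) : count A Y = count B Z := by
  rw [count, count, h]

theorem count_union_of_disjoint {A : Set (EuclideanSpace ℝ (Fin d))}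
    (hb : Bornology.IsBounded A) {Y Z : PointConfig d} (h : Disjoint Y.carrier Z.carrier) :
    count A (Y ∪ Z) = count A Y + count A Z := by
  have : (Y ∪ Z).carrier ∩ A = (Y.carrier ∩ A) ∪ (Z.carrier ∩ A) := Set.union_inter_distrib_right ..
  rw [count, this, Set.ncard_union_eq _ (Y.finite_inter A hb) (Z.finite_inter A hb)]
  · rfl
  · exact h.mono Set.inter_subset_left Set.inter_subset_left

theorem count_biUnion {ι : Type*} (s : Finset ι) {C : ι → Set (EuclideanSpace ℝ (Fin d))}
    (hb : ∀ i ∈ s, Bornology.IsBounded (C i))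
    (hd : ∀ i ∈ s, ∀ j ∈ s, i ≠ j → Disjoint (C i) (C j)) (Y : PointConfig d) :
    count (⋃ i ∈ s, C i) Y = ∑ i ∈ s, count (C i) Y := by
  classical
  induction s using Finset.induction_on with
  | empty => simp [count]
  | insert a s ha ih =>
    rw [Finset.sum_insert ha, ← ih (fun i hi => hb i (Finset.mem_insert_of_mem hi))
      (fun i hi j hj => hd i (Finset.mem_insert_of_mem hi) j (Finset.mem_insert_of_mem hj)),
      Finset.set_biUnion_insert, count, Set.inter_union_distrib_left, Set.ncard_union_eq ?_
        (Y.finite_inter _ (hb a (Finset.mem_insert_self a s)))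
        (Y.finite_inter _ ((Bornology.isBounded_biUnion_finset s).2
          fun i hi => hb i (Finset.mem_insert_of_mem hi)))]
    · rfl
    · refine Disjoint.mono Set.inter_subset_right Set.inter_subset_right ?_
      rw [Set.disjoint_iUnion₂_right]
      intro i hi
      exact hd a (Finset.mem_insert_self a s) i (Finset.mem_insert_of_mem hi)
        (fun h => ha (h ▸ hi))

/-- The restriction `Y ∩ A` of a configuration to a region `A`. -/
def restrict (A : Set (EuclideanSpace ℝ (Fin d))) (Y : PointConfig d) : PointConfig d where
  carrier := Y.carrier ∩ A
  finite_inter := fun B hB =>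
    (Y.finite_inter B hB).subset (Set.inter_subset_inter_left B Set.inter_subset_left)

theorem count_restrict (A B : Set (EuclideanSpace ℝ (Fin d))) (Y : PointConfig d) :
    count B (restrict A Y) = count (B ∩ A) Y := by
  apply count_congr
  simp only [restrict, Set.inter_assoc, Set.inter_comm A B]

theorem measurable_restrict {A : Set (EuclideanSpace ℝ (Fin d))} (hA : MeasurableSet A) :
    Measurable (restrict A) := by
  refine measurable_of_count fun B hB hb => ?_
  simp only [count_restrict]
  exact measurable_count (hB.inter hA) (hb.subset Set.inter_subset_left)

theorem restrict_restrict (A B : Set (EuclideanSpace ℝ (Fin d))) (Y : PointConfig d) :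
    restrict A (restrict B Y) = restrict (B ∩ A) Y := by
  ext x; simp [restrict, and_assoc]

/-- The configuration that agrees with `Y` on `A` and with `Z` off `A`. Averaging over `Z` is
resampling the configuration `Y` outside `A`. -/
def glue (A : Set (EuclideanSpace ℝ (Fin d))) (Y Z : PointConfig d) : PointConfig d :=
  restrict A Y ∪ restrict Aᶜ Z

theorem mem_glue {A : Set (EuclideanSpace ℝ (Fin d))} {Y Z : PointConfig d}
    {x : EuclideanSpace ℝ (Fin d)} :
    x ∈ (glue A Y Z).carrier ↔ (x ∈ Y.carrier ∧ x ∈ A) ∨ (x ∈ Z.carrier ∧ x ∉ A) :=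
  Iff.rfl

theorem count_glue {A B : Set (EuclideanSpace ℝ (Fin d))} (hb : Bornology.IsBounded B)
    (Y Z : PointConfig d) :
    count B (glue A Y Z) = count B (restrict A Y) + count B (restrict Aᶜ Z) :=
  count_union_of_disjoint hb <|
    Disjoint.mono Set.inter_subset_right Set.inter_subset_right disjoint_compl_right

theorem measurable_glue {A : Set (EuclideanSpace ℝ (Fin d))} (hA : MeasurableSet A) :
    Measurable fun p : PointConfig d × PointConfig d => glue A p.1 p.2 := by
  refine measurable_of_count fun B hB hb => ?_
  simp only [count_glue hb]
  exact ((measurable_count hB hb).comp ((measurable_restrict hA).comp measurable_fst)).add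
    ((measurable_count hB hb).comp ((measurable_restrict hA.compl).comp measurable_snd))

theorem glue_glue (A B : Set (EuclideanSpace ℝ (Fin d))) (Y Z W : PointConfig d) :
    glue B (glue A Y Z) W = glue (A ∩ B) Y (glue B Z W) := by
  ext x
  simp only [mem_glue, Set.mem_inter_iff]
  tauto

theorem glue_empty (Y Z : PointConfig d) : glue ∅ Y Z = Z := by
  ext x; simp [mem_glue]

theorem restrict_glue (A : Set (EuclideanSpace ℝ (Fin d))) (Y Z : PointConfig d) :
    restrict A (glue A Y Z) = restrict A Y := by
  ext x
  change (_ ∧ _) ↔ (_ ∧ _)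
  rw [mem_glue]
  tauto

/-- The dilated configuration `c • Y`. -/
def dilate (c : ℝ) (hc : c ≠ 0) (Y : PointConfig d) : PointConfig d where
  carrier := (fun x => c • x) '' Y.carrier
  finite_inter := fun B hB => by
    have h1 : Bornology.IsBounded ((fun x => c • x) ⁻¹' B) := by
      have := hB.smul₀ c⁻¹
      rwa [Set.preimage_smul₀ hc]
    refine ((Y.finite_inter _ h1).image fun x => c • x).subset ?_
    rintro _ ⟨⟨x, hx, rfl⟩, hxB⟩
    exact ⟨x, ⟨hx, hxB⟩, rfl⟩

theorem count_dilate {c : ℝ} (hc : c ≠ 0) (A : Set (EuclideanSpace ℝ (Fin d)))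
    (Y : PointConfig d) : count A (dilate c hc Y) = count ((fun x => c • x) ⁻¹' A) Y := by
  rw [count, count, dilate, ← Set.image_inter_preimage,
    Set.ncard_image_of_injective _ (smul_right_injective _ hc)]

end PointConfig

/-! ### The law of a Poisson process -/

section

/-- The random configuration `X` is a Poisson process with intensity measure `μ`: its counts in
finitely many disjoint bounded Borel sets are independent Poisson variables with means `μ (A i)`,
expressed as an equality of joint laws. Non-stationary intensities are needed because the
restriction of a Poisson process to a region is again one. -/
structure HasPoissonLaw {d : ℕ} {α : Type*} [MeasurableSpace α] (P : Measure α)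
    (X : α → PointConfig d) (μ : Measure (EuclideanSpace ℝ (Fin d))) : Prop where
  measurable : Measurable X
  map_counts : ∀ (n : ℕ) (A : Fin n → Set (EuclideanSpace ℝ (Fin d))),
    (∀ i, MeasurableSet (A i)) → (∀ i, Bornology.IsBounded (A i)) →
    Pairwise (fun i j => Disjoint (A i) (A j)) →
    P.map (fun ω i => (X ω).count (A i)) = Measure.pi fun i => poissonMeasure (μ (A i)).toNNReal

open PointConfig

variable {d : ℕ} {α β : Type*} [MeasurableSpace α] [MeasurableSpace β]
  {P : Measure α} {P' : Measure β} {X : α → PointConfig d} {X' : β → PointConfig d}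
  {μ ν : Measure (EuclideanSpace ℝ (Fin d))}

theorem IsPoissonProcess.hasPoissonLaw [IsProbabilityMeasure P] {lam : ℝ} (hlam : 0 ≤ lam)
    (hX : IsPoissonProcess P X lam) : HasPoissonLaw P X (ENNReal.ofReal lam • volume) where
  measurable := hX.measurable
  map_counts n A hA hb hd := by
    have hm (i : Fin n) : Measurable fun ω => (X ω).count (A i) :=
      (measurable_count (hA i) (hb i)).comp hX.measurable
    rw [(iIndepFun_iff_map_fun_eq_pi_map fun i => (hm i).aemeasurable).1
      (hX.indep_count n A hA hb hd)]
    congr 1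
    ext1 i
    rw [hX.map_count (A i) (hA i) (hb i)]
    congr 1
    rw [Measure.smul_apply, smul_eq_mul, ENNReal.toNNReal_mul, Real.toNNReal_mul hlam,
      ENNReal.ofReal, ENNReal.toNNReal_coe, measureReal_def, ENNReal.toReal, Real.toNNReal_coe]

theorem pi_prod_pi_map_add {n : ℕ} (p q : Fin n → Measure ℕ) [∀ i, IsProbabilityMeasure (p i)]
    [∀ i, IsProbabilityMeasure (q i)] :
    ((Measure.pi p).prod (Measure.pi q)).map (fun v => v.1 + v.2) =
      Measure.pi fun i => p i ∗ q i := by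
  rw [← (measurePreserving_arrowProdEquivProdArrow ℕ ℕ (Fin n) p q).map_eq,
    Measure.map_map .of_discrete (MeasurableEquiv.measurable _)]
  simp only [Measure.conv]
  have (i : Fin n) : IsProbabilityMeasure (((p i).prod (q i)).map fun x => x.1 + x.2) :=
    Measure.isProbabilityMeasure_map .of_discrete
  rw [← Measure.pi_map_pi (fun i => .of_discrete)]
  rfl

namespace HasPoissonLaw

theorem map_counts_fintype (hX : HasPoissonLaw P X μ) {ι : Type*} [Fintype ι]
    (A : ι → Set (EuclideanSpace ℝ (Fin d)))
    (hA : ∀ i, MeasurableSet (A i)) (hb : ∀ i, Bornology.IsBounded (A i))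
    (hd : Pairwise (fun i j => Disjoint (A i) (A j))) :
    P.map (fun ω i => (X ω).count (A i)) =
      Measure.pi fun i => poissonMeasure (μ (A i)).toNNReal := by
  have e := (Fintype.equivFin ι).symm
  have h := hX.map_counts _ (fun k => A (e k)) (fun k => hA _) (fun k => hb _)
    fun i j hij => hd (e.injective.ne hij)
  refine Measure.ext_of_singleton fun v => ?_
  have h2 := congrArg (fun m => m {fun k => v (e k)}) h
  simp only [Measure.pi_singleton] at h2 ⊢
  rw [e.prod_comp fun i => poissonMeasure (μ (A i)).toNNReal {v i}] at h2
  rw [← h2, Measure.map_apply (measurable_counts hX.measurable hA hb) (measurableSet_singleton v),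
    Measure.map_apply (measurable_counts hX.measurable (fun k => hA _) fun k => hb _)
      (measurableSet_singleton _)]
  congr 1
  ext ω
  simp only [Set.mem_preimage, Set.mem_singleton_iff, funext_iff]
  exact (e.forall_congr_right (q := fun i => count (A i) (X ω) = v i)).symm

theorem map_count (hX : HasPoissonLaw P X μ) {A : Set (EuclideanSpace ℝ (Fin d))}
    (hA : MeasurableSet A) (hb : Bornology.IsBounded A) :
    P.map (fun ω => (X ω).count A) = poissonMeasure (μ A).toNNReal := by
  have h := hX.map_counts_fintype (fun _ : Unit => A) (fun _ => hA) (fun _ => hb)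
    (fun i j hij => (hij rfl).elim)
  have h2 := congrArg (fun m => m.map (Function.eval ())) h
  rw [Measure.map_map (measurable_pi_apply _)
    (measurable_counts hX.measurable (fun _ => hA) fun _ => hb),
    (measurePreserving_eval _ _).map_eq] at h2
  exact h2

/-- The joint law of the counts of a Poisson process in finitely many bounded Borel sets, disjoint
or not, depends on the intensity only: all counts are sums of counts in the atoms of the finite
set algebra generated by the sets. -/
theorem map_counts_eq (hX : HasPoissonLaw P X μ) (hX' : HasPoissonLaw P' X' μ)
    {ι : Type*} [Fintype ι] (A : ι → Set (EuclideanSpace ℝ (Fin d)))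
    (hA : ∀ i, MeasurableSet (A i)) (hb : ∀ i, Bornology.IsBounded (A i)) :
    P.map (fun ω i => (X ω).count (A i)) = P'.map (fun ω i => (X' ω).count (A i)) := by
  classical
  let C : Finset ι → Set (EuclideanSpace ℝ (Fin d)) := fun b =>
    (⋃ i, A i) ∩ ⋂ i, if i ∈ b then A i else (A i)ᶜ
  have mem_C (b : Finset ι) (x) : x ∈ C b ↔ (∃ i, x ∈ A i) ∧ ∀ i, x ∈ A i ↔ i ∈ b := by
    simp only [C, Set.mem_inter_iff, Set.mem_iUnion, Set.mem_iInter]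
    refine and_congr Iff.rfl (forall_congr' fun i => ?_)
    split_ifs with h <;> simp [h]
  have hC (b) : MeasurableSet (C b) := by
    refine (MeasurableSet.iUnion hA).inter (MeasurableSet.iInter fun i => ?_)
    split_ifs
    exacts [hA i, (hA i).compl]
  have hCb (b) : Bornology.IsBounded (C b) :=
    (Bornology.isBounded_iUnion.2 hb).subset Set.inter_subset_left
  have hCd (b b' : Finset ι) (h : b ≠ b') : Disjoint (C b) (C b') := by
    refine Set.disjoint_left.2 fun x hx hx' => h ?_
    rw [mem_C] at hx hx'
    ext i
    rw [← hx.2, ← hx'.2]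
  have key (i : ι) (Y : PointConfig d) :
      Y.count (A i) = ∑ b ∈ Finset.univ.filter (fun b : Finset ι => i ∈ b), Y.count (C b) := by
    rw [← count_biUnion _ (fun b _ => hCb b) (fun b _ b' _ => hCd b b')]
    congr 1
    ext x
    simp only [Finset.mem_filter, Finset.mem_univ, true_and, Set.mem_iUnion, exists_prop, mem_C]
    constructor
    · intro hx
      exact ⟨Finset.univ.filter fun j => x ∈ A j, by simpa using hx, ⟨i, hx⟩, by simp⟩
    · rintro ⟨b, hib, -, h⟩
      exact (h i).2 hib
  let φ : (Finset ι → ℕ) → ι → ℕ := fun v i =>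
    ∑ b ∈ Finset.univ.filter (fun b : Finset ι => i ∈ b), v b
  have hφ : Measurable φ := measurable_pi_lambda _ fun i =>
    Finset.measurable_sum _ fun b _ => measurable_pi_apply b
  have e1 : P.map (fun ω i => (X ω).count (A i)) =
      (P.map fun ω b => (X ω).count (C b)).map φ := by
    rw [Measure.map_map hφ (measurable_counts hX.measurable hC hCb)]
    congr 1
    ext ω i
    exact key i _
  have e2 : P'.map (fun ω i => (X' ω).count (A i)) =
      (P'.map fun ω b => (X' ω).count (C b)).map φ := by
    rw [Measure.map_map hφ (measurable_counts hX'.measurable hC hCb)]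
    congr 1
    ext ω i
    exact key i _
  rw [e1, e2, hX.map_counts_fintype C hC hCb hCd, hX'.map_counts_fintype C hC hCb hCd]

/-- The intensity measure determines the law of a Poisson process. -/
theorem map_eq [IsProbabilityMeasure P] [IsProbabilityMeasure P']
    (hX : HasPoissonLaw P X μ) (hX' : HasPoissonLaw P' X' μ) : P.map X = P'.map X' := by
  let I := {A : Set (EuclideanSpace ℝ (Fin d)) // MeasurableSet A ∧ Bornology.IsBounded A}
  let m : I → MeasurableSpace (PointConfig d) := fun A => MeasurableSpace.comap (count A.1) ⊤
  have hgen : (instMeasurableSpace : MeasurableSpace (PointConfig d)) =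
      MeasurableSpace.generateFrom
        (piiUnionInter (fun i : I => {s | MeasurableSet[m i] s}) Set.univ) := by
    rw [generateFrom_piiUnionInter_measurableSet m]
    simp only [instMeasurableSpace, Set.mem_univ, iSup_pos, m, I, iSup_subtype, iSup_and]
  have := Measure.isProbabilityMeasure_map (μ := P) hX.measurable.aemeasurable
  have := Measure.isProbabilityMeasure_map (μ := P') hX'.measurable.aemeasurable
  refine ext_of_generate_finite _ hgen
    (isPiSystem_piiUnionInter _ (fun i => @MeasurableSpace.isPiSystem_measurableSet _ (m i)) _)
    ?_ (by simp)
  rintro s ⟨t, -, F, hF, rfl⟩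
  have hF' (i : I) : ∃ T : Set ℕ, i ∈ t → count i.1 ⁻¹' T = F i := by
    by_cases hi : i ∈ t
    · obtain ⟨T, -, hT⟩ := hF i hi
      exact ⟨T, fun _ => hT⟩
    · exact ⟨∅, fun h => (hi h).elim⟩
  choose T hT using hF'
  have hA (i : t) : MeasurableSet i.1.1 := i.1.2.1
  have hb (i : t) : Bornology.IsBounded i.1.1 := i.1.2.2
  have hset : (⋂ x ∈ t, F x) =
      (fun Y (i : t) => count i.1.1 Y) ⁻¹' (Set.univ.pi fun i : t => T i.1) := by
    ext Y
    simp only [Set.mem_iInter, Set.mem_preimage, Set.mem_pi, Set.mem_univ, true_imp_iff,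
      Subtype.forall]
    exact forall₂_congr fun i hi => by rw [← hT i hi]; rfl
  have hms : MeasurableSet (Set.univ.pi fun i : t => T i.1) :=
    MeasurableSet.univ_pi fun i => MeasurableSet.of_discrete
  have h := map_counts_eq hX hX' (fun i : t => i.1.1) hA hb
  have hc : Measurable fun (Y : PointConfig d) (i : t) => count i.1.1 Y :=
    measurable_counts (X := id) measurable_id hA hb
  rw [hset, ← Measure.map_apply hc hms, ← Measure.map_apply hc hms,
    Measure.map_map hc hX.measurable, Measure.map_map hc hX'.measurable]
  exact congrArg (fun ρ : Measure (t → ℕ) => ρ _) h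

theorem map_id [IsProbabilityMeasure P] (hX : HasPoissonLaw P X μ) :
    HasPoissonLaw (P.map X) id μ where
  measurable := measurable_id
  map_counts n A hA hb hd := by
    rw [← hX.map_counts n A hA hb hd,
      Measure.map_map (measurable_counts measurable_id hA hb) hX.measurable]
    rfl

theorem restrict (hX : HasPoissonLaw P X μ) {A : Set (EuclideanSpace ℝ (Fin d))}
    (hA : MeasurableSet A) :
    HasPoissonLaw P (fun ω => PointConfig.restrict A (X ω)) (μ.restrict A) where
  measurable := (measurable_restrict hA).comp hX.measurable
  map_counts n B hB hb hd := by
    simp only [count_restrict, fun i => Measure.restrict_apply (μ := μ) (s := A) (hB i)]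
    exact hX.map_counts n (fun i => B i ∩ A) (fun i => (hB i).inter hA)
      (fun i => (hb i).subset Set.inter_subset_left)
      fun i j hij => (hd hij).mono Set.inter_subset_left Set.inter_subset_left

theorem dilate {lam : ℝ} (hX : HasPoissonLaw P X (ENNReal.ofReal lam • volume))
    {c : ℝ} (hc : 0 < c) :
    HasPoissonLaw P (fun ω => PointConfig.dilate c hc.ne' (X ω))
      (ENNReal.ofReal (lam / c ^ d) • volume) := by
  have hm : Measurable fun x : EuclideanSpace ℝ (Fin d) => c • x := measurable_const_smul c
  have hb' {A : Set (EuclideanSpace ℝ (Fin d))} (hb : Bornology.IsBounded A) :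
      Bornology.IsBounded ((fun x => c • x) ⁻¹' A) := by
    have := hb.smul₀ c⁻¹
    rwa [Set.preimage_smul₀ hc.ne']
  refine ⟨measurable_of_count fun A hA hb => ?_, fun n A hA hb hd => ?_⟩
  · simp only [count_dilate]
    exact (measurable_count (hm hA) (hb' hb)).comp hX.measurable
  · simp only [count_dilate]
    rw [hX.map_counts n (fun i => (fun x => c • x) ⁻¹' A i) (fun i => hm (hA i))
      (fun i => hb' (hb i)) fun i j hij => (hd hij).preimage _]
    congr 1
    ext1 i
    congr 2
    rw [Measure.smul_apply, Measure.smul_apply, Measure.addHaar_preimage_smul _ hc.ne',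
      finrank_euclideanSpace_fin, smul_eq_mul, smul_eq_mul, ← mul_assoc, abs_of_pos (by positivity),
      div_eq_mul_inv, ENNReal.ofReal_mul' (by positivity)]

/-- The superposition theorem: `Z` has the law of a Poisson process with intensity `μ + ν` as soon
as its counts are sums of those of the two independent Poisson processes. -/
theorem superposition [IsProbabilityMeasure P] [IsProbabilityMeasure P']
    [IsFiniteMeasureOnCompacts μ] [IsFiniteMeasureOnCompacts ν]
    (hX : HasPoissonLaw P X μ) (hX' : HasPoissonLaw P' X' ν)
    {Z : α × β → PointConfig d} (hZ : Measurable Z)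
    (h : ∀ A : Set (EuclideanSpace ℝ (Fin d)), MeasurableSet A → Bornology.IsBounded A →
      ∀ᵐ p ∂P.prod P', (Z p).count A = (X p.1).count A + (X' p.2).count A) :
    HasPoissonLaw (P.prod P') Z (μ + ν) where
  measurable := hZ
  map_counts n A hA hb hd := by
    have hm := measurable_counts hX.measurable hA hb
    have hm' := measurable_counts hX'.measurable hA hb
    have e : (fun ω i => (Z ω).count (A i)) =ᵐ[P.prod P']
        (fun v => v.1 + v.2) ∘ Prod.map (fun ω i => (X ω).count (A i))
          (fun ω i => (X' ω).count (A i)) := by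
      filter_upwards [ae_all_iff.2 fun i => h (A i) (hA i) (hb i)] with p hp
      ext i
      exact hp i
    rw [Measure.map_congr e, ← Measure.map_map .of_discrete (hm.prodMap hm'),
      ← Measure.map_prod_map _ _ hm hm', hX.map_counts n A hA hb hd, hX'.map_counts n A hA hb hd,
      pi_prod_pi_map_add]
    congr 1
    ext1 i
    rw [poissonMeasure_conv_poissonMeasure, Measure.add_apply, ENNReal.toNNReal_add
      (hb i).measure_lt_top.ne (hb i).measure_lt_top.ne]

/-- Resampling the configuration outside `A` preserves the law of a Poisson process. -/
theorem measurePreserving_glue {Q : Measure (PointConfig d)} [IsProbabilityMeasure Q]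
    [IsFiniteMeasureOnCompacts μ] (hQ : HasPoissonLaw Q id μ)
    {A : Set (EuclideanSpace ℝ (Fin d))} (hA : MeasurableSet A) :
    MeasurePreserving (fun p : PointConfig d × PointConfig d => glue A p.1 p.2) (Q.prod Q) Q := by
  refine ⟨measurable_glue hA, ?_⟩
  have h := superposition (hQ.restrict hA) (hQ.restrict hA.compl) (measurable_glue hA)
    fun B _ hb => .of_forall fun p => count_glue hb p.1 p.2
  rw [Measure.restrict_add_restrict_compl hA] at h
  rw [map_eq h hQ, Measure.map_id]

end HasPoissonLaw

end

/-! ### The Efron–Stein inequality -/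

section

open PointConfig

variable {d : ℕ} {Q : Measure (PointConfig d)} {A B : Set (EuclideanSpace ℝ (Fin d))}
  {S g : PointConfig d → ℝ} {M : ℝ}

/-- A law `Q` on configurations is resampling invariant if replacing the part of a `Q`-distributed
configuration outside any Borel set `A` by that of an independent copy yields `Q` again. This is the
only property of a Poisson process that the Efron–Stein inequality uses. -/
def ResamplingInvariant (Q : Measure (PointConfig d)) : Prop :=
  ∀ A : Set (EuclideanSpace ℝ (Fin d)), MeasurableSet A →
    MeasurePreserving (fun p : PointConfig d × PointConfig d => glue A p.1 p.2) (Q.prod Q) Q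

/-- The average of `S` over resampling the configuration outside `A`: for resampling invariant `Q`,
an explicit version of the conditional expectation of `S` given the configuration in `A`. -/
noncomputable def condAvg (Q : Measure (PointConfig d)) (A : Set (EuclideanSpace ℝ (Fin d)))
    (S : PointConfig d → ℝ) (Y : PointConfig d) : ℝ :=
  ∫ Z, S (glue A Y Z) ∂Q

/-- The mean square error of predicting `S` from the configuration in `A`. -/
noncomputable def predictionError (Q : Measure (PointConfig d)) (A : Set (EuclideanSpace ℝ (Fin d)))
    (S : PointConfig d → ℝ) : ℝ :=
  ∫ Y, (S Y - condAvg Q A S Y) ^ 2 ∂Q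

theorem measurable_condAvg [SFinite Q] (hA : MeasurableSet A) (hS : Measurable S) :
    Measurable (condAvg Q A S) :=
  ((hS.comp (measurable_glue hA)).stronglyMeasurable.integral_prod_right').measurable

theorem abs_condAvg_le [IsProbabilityMeasure Q] (hM : ∀ Y, |S Y| ≤ M) (Y : PointConfig d) :
    |condAvg Q A S Y| ≤ M := by
  have := norm_integral_le_of_norm_le_const (μ := Q)
    (.of_forall fun Z => (Real.norm_eq_abs _).trans_le (hM (glue A Y Z)))
  simpa [condAvg] using this

theorem condAvg_glue (Y Z : PointConfig d) :
    condAvg Q A S (glue A Y Z) = condAvg Q A S Y := by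
  refine integral_congr_ae (.of_forall fun W => ?_)
  have : glue A (glue A Y Z) W = glue A Y W := by
    ext x
    simp only [mem_glue]
    tauto
  simp only [this]

theorem integrable_of_abs_le {α : Type*} [MeasurableSpace α] {P : Measure α} [IsFiniteMeasure P]
    {f : α → ℝ} {M : ℝ} (hf : Measurable f) (hM : ∀ a, |f a| ≤ M) : Integrable f P :=
  .of_bound hf.aestronglyMeasurable M (.of_forall hM)

/-- Averaging over the configuration outside `A` is self-adjoint. -/
theorem integral_mul_eq_integral_condAvg_mul [IsProbabilityMeasure Q]
    (hQ : ResamplingInvariant Q) (hA : MeasurableSet A) (hS : Measurable S)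
    (hM : ∀ Y, |S Y| ≤ M) (hg : Measurable g) {K : ℝ} (hK : ∀ Y, |g Y| ≤ K)
    (hgA : ∀ Y Z, g (glue A Y Z) = g Y) :
    ∫ Y, S Y * g Y ∂Q = ∫ Y, condAvg Q A S Y * g Y ∂Q := by
  have hi : Integrable (fun p : PointConfig d × PointConfig d => S (glue A p.1 p.2) * g p.1)
      (Q.prod Q) := by
    refine integrable_of_abs_le (M := M * K)
      ((hS.comp (measurable_glue hA)).mul (hg.comp measurable_fst)) fun p => ?_
    rw [abs_mul]
    exact mul_le_mul (hM _) (hK _) (abs_nonneg _) ((abs_nonneg _).trans (hM (glue A p.1 p.2)))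
  conv_lhs => rw [← (hQ A hA).map_eq]
  rw [integral_map (hQ A hA).measurable.aemeasurable (by fun_prop)]
  simp only [hgA]
  rw [integral_prod _ hi]
  simp only [integral_mul_const]
  rfl

/-- Pythagoras: `condAvg Q A S` is the orthogonal projection of `S` to the functions of the
configuration in `A`. -/
theorem integral_sub_sq_eq [IsProbabilityMeasure Q] (hQ : ResamplingInvariant Q)
    (hA : MeasurableSet A) (hS : Measurable S) (hM : ∀ Y, |S Y| ≤ M) (hg : Measurable g)
    {K : ℝ} (hK : ∀ Y, |g Y| ≤ K) (hgA : ∀ Y Z, g (glue A Y Z) = g Y) :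
    ∫ Y, (S Y - g Y) ^ 2 ∂Q = predictionError Q A S + ∫ Y, (condAvg Q A S Y - g Y) ^ 2 ∂Q := by
  have hc := measurable_condAvg (Q := Q) hA hS
  have hcM := abs_condAvg_le (Q := Q) (A := A) hM
  have hh : Measurable fun Y => condAvg Q A S Y - g Y := hc.sub hg
  have hhK (Y) : |condAvg Q A S Y - g Y| ≤ M + K :=
    (abs_sub _ _).trans (add_le_add (hcM Y) (hK Y))
  have bdd {u v : PointConfig d → ℝ} {a b : ℝ} (hu : Measurable u) (hv : Measurable v)
      (ha : ∀ Y, |u Y| ≤ a) (hb : ∀ Y, |v Y| ≤ b) : Integrable (fun Y => u Y * v Y) Q :=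
    integrable_of_abs_le (M := a * b) (hu.mul hv) fun Y => by
      rw [abs_mul]
      exact mul_le_mul (ha Y) (hb Y) (abs_nonneg _) ((abs_nonneg _).trans (ha Y))
  have horth := integral_mul_eq_integral_condAvg_mul hQ hA hS hM hh hhK
    fun Y Z => by rw [condAvg_glue, hgA]
  have hSc : Measurable fun Y => S Y - condAvg Q A S Y := hS.sub hc
  have hScM (Y) : |S Y - condAvg Q A S Y| ≤ M + M :=
    (abs_sub _ _).trans (add_le_add (hM Y) (hcM Y))
  have e : ∀ Y, (S Y - g Y) ^ 2 = (S Y - condAvg Q A S Y) ^ 2 +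
      (condAvg Q A S Y - g Y) ^ 2 + 2 * (S Y * (condAvg Q A S Y - g Y) -
        condAvg Q A S Y * (condAvg Q A S Y - g Y)) := fun Y => by ring
  have i1 : Integrable (fun Y => (S Y - condAvg Q A S Y) ^ 2) Q := by
    simpa only [sq] using bdd hSc hSc hScM hScM
  have i2 : Integrable (fun Y => (condAvg Q A S Y - g Y) ^ 2) Q := by
    simpa only [sq] using bdd hh hh hhK hhK
  have i3 := bdd hS hh hM hhK
  have i4 := bdd hc hh hcM hhK
  have i12 : Integrable (fun Y => (S Y - condAvg Q A S Y) ^ 2 + (condAvg Q A S Y - g Y) ^ 2) Q :=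
    i1.add i2
  have i34 : Integrable (fun Y => 2 * (S Y * (condAvg Q A S Y - g Y) -
      condAvg Q A S Y * (condAvg Q A S Y - g Y))) Q := (i3.sub i4).const_mul 2
  simp only [e]
  rw [integral_add i12 i34, integral_add i1 i2,
    integral_const_mul, integral_sub i3 i4, horth, sub_self, mul_zero, add_zero, predictionError]

theorem predictionError_le [IsProbabilityMeasure Q] (hQ : ResamplingInvariant Q)
    (hA : MeasurableSet A) (hS : Measurable S) (hM : ∀ Y, |S Y| ≤ M) (hg : Measurable g)
    {K : ℝ} (hK : ∀ Y, |g Y| ≤ K) (hgA : ∀ Y Z, g (glue A Y Z) = g Y) :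
    predictionError Q A S ≤ ∫ Y, (S Y - g Y) ^ 2 ∂Q := by
  rw [integral_sub_sq_eq hQ hA hS hM hg hK hgA]
  exact le_add_of_nonneg_right (integral_nonneg fun Y => sq_nonneg _)

theorem condAvg_condAvg [IsProbabilityMeasure Q] (hQ : ResamplingInvariant Q)
    (hB : MeasurableSet B) (hA : MeasurableSet A) (hS : Measurable S) (hM : ∀ Y, |S Y| ≤ M)
    (Y : PointConfig d) : condAvg Q A (condAvg Q B S) Y = condAvg Q (A ∩ B) S Y := by
  have hm : Measurable fun Z => S (glue (A ∩ B) Y Z) :=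
    hS.comp ((measurable_glue (hA.inter hB)).comp measurable_prodMk_left)
  rw [condAvg, condAvg]
  conv_rhs => rw [← (hQ B hB).map_eq]
  have hi : Integrable (fun p : PointConfig d × PointConfig d =>
      S (glue (A ∩ B) Y (glue B p.1 p.2))) (Q.prod Q) :=
    integrable_of_abs_le (hm.comp (measurable_glue hB)) fun p => hM _
  rw [integral_map (hQ B hB).measurable.aemeasurable hm.aestronglyMeasurable, integral_prod _ hi]
  simp only [← glue_glue]
  rfl

/-- The Efron–Stein inequality for two regions. -/
theorem predictionError_inter_le [IsProbabilityMeasure Q] (hQ : ResamplingInvariant Q)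
    (hA : MeasurableSet A) (hB : MeasurableSet B) (hS : Measurable S) (hM : ∀ Y, |S Y| ≤ M) :
    predictionError Q (A ∩ B) S ≤ predictionError Q A S + predictionError Q B S := by
  have hc := measurable_condAvg (Q := Q) hB hS
  have hcM := abs_condAvg_le (Q := Q) (A := B) hM
  have h1 := integral_sub_sq_eq hQ hA hS hM (measurable_condAvg (Q := Q) hA hc)
    (abs_condAvg_le hcM) condAvg_glue
  -- averaging is a contraction: Pythagoras for `S - condAvg Q B S`, with `g = 0`
  have h2 := integral_sub_sq_eq (g := 0) hQ hA (hS.sub hc)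
    (fun Y => (abs_sub _ _).trans (add_le_add (hM Y) (hcM Y))) measurable_const
    (K := 0) (by simp) (by simp)
  have h3 (Y : PointConfig d) : condAvg Q A (S - condAvg Q B S) Y =
      condAvg Q A S Y - condAvg Q A (condAvg Q B S) Y := by
    have hl : Measurable fun Z => glue A Y Z := (measurable_glue hA).comp measurable_prodMk_left
    exact integral_sub (integrable_of_abs_le (hS.comp hl) fun Z => hM _)
      (integrable_of_abs_le (hc.comp hl) fun Z => hcM _)
  simp only [h3, Pi.zero_apply, sub_zero, Pi.sub_apply] at h2
  simp only [condAvg_condAvg hQ hB hA hS hM] at h1 h2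
  have h4 : 0 ≤ predictionError Q A (S - condAvg Q B S) := integral_nonneg fun Y => sq_nonneg _
  rw [predictionError, h1]
  change _ ≤ _ + ∫ Y, (S Y - condAvg Q B S Y) ^ 2 ∂Q
  linarith

theorem predictionError_univ [IsProbabilityMeasure Q] : predictionError Q Set.univ S = 0 := by
  have (Y : PointConfig d) : condAvg Q Set.univ S Y = S Y := by
    have (Z : PointConfig d) : glue Set.univ Y Z = Y := by ext x; simp [mem_glue]
    simp [condAvg, this]
  simp [predictionError, this]

theorem predictionError_biInter_le [IsProbabilityMeasure Q] (hQ : ResamplingInvariant Q)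
    {A : ℕ → Set (EuclideanSpace ℝ (Fin d))} (hA : ∀ i, MeasurableSet (A i))
    (hS : Measurable S) (hM : ∀ Y, |S Y| ≤ M) (s : Finset ℕ) :
    predictionError Q (⋂ i ∈ s, A i) S ≤ ∑ i ∈ s, predictionError Q (A i) S := by
  induction s using Finset.induction_on with
  | empty => simp [predictionError_univ]
  | insert a s ha ih =>
    rw [Finset.sum_insert ha, Finset.set_biInter_insert]
    refine (predictionError_inter_le hQ (hA a) (Finset.measurableSet_biInter s fun i _ => hA i)
      hS hM).trans ?_
    gcongr

theorem predictionError_empty [IsProbabilityMeasure Q] (hS : Measurable S) :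
    predictionError Q ∅ S = Var[S; Q] := by
  rw [variance_eq_integral hS.aemeasurable]
  simp only [predictionError, condAvg, glue_empty]

/-- The σ-algebras generated by the configuration in the balls of integer radius about `0`. -/
noncomputable def ballFiltration (d : ℕ) :
    Filtration ℕ (instMeasurableSpace : MeasurableSpace (PointConfig d)) where
  seq n := MeasurableSpace.comap (restrict (Metric.closedBall 0 (n : ℝ))) inferInstance
  mono' m n hmn := by
    have : restrict (Metric.closedBall (0 : EuclideanSpace ℝ (Fin d)) (m : ℝ)) =
        restrict (Metric.closedBall 0 (m : ℝ)) ∘ restrict (Metric.closedBall 0 (n : ℝ)) := by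
      ext1 Y
      rw [Function.comp_apply, restrict_restrict, Set.inter_eq_right.2]
      exact Metric.closedBall_subset_closedBall (by exact_mod_cast hmn)
    simp only
    conv_lhs => rw [this, ← MeasurableSpace.comap_comp]
    exact MeasurableSpace.comap_mono (measurable_restrict measurableSet_closedBall).comap_le
  le' n := (measurable_restrict measurableSet_closedBall).comap_le

theorem iSup_ballFiltration (d : ℕ) :
    ⨆ n, (ballFiltration d n : MeasurableSpace (PointConfig d)) = instMeasurableSpace := by
  refine le_antisymm (iSup_le (ballFiltration d).le) ?_
  refine iSup_le fun A => iSup_le fun hA => iSup_le fun hb => ?_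
  obtain ⟨r, hr⟩ := hb.subset_closedBall 0
  obtain ⟨n, hn⟩ := exists_nat_ge r
  refine le_iSup_of_le n ?_
  have : count A = count A ∘ restrict (Metric.closedBall 0 (n : ℝ)) := by
    ext1 Y
    rw [Function.comp_apply, count_restrict, Set.inter_eq_left.2]
    exact hr.trans (Metric.closedBall_subset_closedBall hn)
  conv_lhs => rw [this, ← MeasurableSpace.comap_comp]
  exact MeasurableSpace.comap_mono (measurable_count hA hb).comap_le

/-- A bounded functional is determined up to a small error by the configuration in a large ball;
this is Lévy's upward theorem. -/
theorem exists_predictionError_closedBall_lt [IsProbabilityMeasure Q] (hQ : ResamplingInvariant Q)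
    (hS : Measurable S) (hM : ∀ Y, |S Y| ≤ M) {ε : ℝ} (hε : 0 < ε) :
    ∃ n : ℕ, predictionError Q (Metric.closedBall 0 (n : ℝ)) S < ε := by
  have hconv := (integrable_of_abs_le (P := Q) hS hM).tendsto_ae_condExp (ℱ := ballFiltration d)
    (by rw [iSup_ballFiltration]; exact hS.stronglyMeasurable)
  -- the conditional expectations are truncated, so that they are bounded everywhere
  let G (n : ℕ) (Y : PointConfig d) : ℝ := max (-M) (min M ((Q[S | ballFiltration d n]) Y))
  have hG' (n) : StronglyMeasurable[ballFiltration d n] (G n) :=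
    (continuous_const.max (continuous_const.min continuous_id)).comp_stronglyMeasurable
      stronglyMeasurable_condExp
  have hG (n) : Measurable (G n) := ((hG' n).mono ((ballFiltration d).le n)).measurable
  obtain ⟨Y₀⟩ : Nonempty (PointConfig d) := nonempty_of_isProbabilityMeasure Q
  have hM0 : 0 ≤ M := (abs_nonneg _).trans (hM Y₀)
  have hGM (n Y) : |G n Y| ≤ M :=
    abs_le.2 ⟨le_max_left _ _, max_le (by linarith) (min_le_left _ _)⟩
  have hlim : Tendsto (fun n => ∫ Y, (S Y - G n Y) ^ 2 ∂Q) atTop (nhds (∫ _, (0 : ℝ) ∂Q)) := by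
    refine tendsto_integral_of_dominated_convergence (fun _ => (M + M) ^ 2)
      (fun n => ((hS.sub (hG n)).pow_const 2).aestronglyMeasurable) (integrable_const _)
      (fun n => .of_forall fun Y => ?_) ?_
    · rw [Real.norm_eq_abs, abs_pow]
      exact pow_le_pow_left₀ (abs_nonneg _)
        ((abs_sub _ _).trans (add_le_add (hM Y) (hGM n Y))) 2
    · filter_upwards [hconv] with Y hY
      have h1 : Tendsto (fun n => G n Y) atTop (nhds (S Y)) := by
        have := (tendsto_const_nhds (x := -M)).max ((tendsto_const_nhds (x := M)).min hY)
        rwa [min_eq_right (abs_le.1 (hM Y)).2, max_eq_right (abs_le.1 (hM Y)).1] at this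
      simpa using ((tendsto_const_nhds (x := S Y)).sub h1).pow 2
  rw [integral_zero] at hlim
  obtain ⟨n, hn⟩ := (hlim.eventually (gt_mem_nhds hε)).exists
  refine ⟨n, (predictionError_le hQ measurableSet_closedBall hS hM (hG n) (hGM n)
    fun Y Z => ?_).trans_lt hn⟩
  exact (hG' n).factorsThrough (restrict_glue _ Y Z)

end

section

open PointConfig

variable {d : ℕ} {α β : Type*} [MeasurableSpace α] [MeasurableSpace β]
  {P : Measure α} {P' : Measure β} {X : α → PointConfig d} {X' : β → PointConfig d}
  {μ ν : Measure (EuclideanSpace ℝ (Fin d))} {lam : ℝ}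
  {S : PointConfig d → ℝ} {M : ℝ}

/-! ### Cutting a ball into cells of small volume -/

/-- In positive dimension a ball can be cut into finitely many pieces of small volume. -/
theorem exists_partition_closedBall (hd : 1 ≤ d) (r : ℝ) {δ : ENNReal} (hδ : δ ≠ 0) :
    ∃ (N : ℕ) (C : ℕ → Set (EuclideanSpace ℝ (Fin d))), (∀ i, MeasurableSet (C i)) ∧
      Pairwise (fun i j => Disjoint (C i) (C j)) ∧ (∀ i, volume (C i) ≤ δ) ∧
      ⋃ i ∈ Finset.range N, C i = Metric.closedBall 0 r := by
  have : Nonempty (Fin d) := ⟨⟨0, hd⟩⟩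
  obtain ⟨U, hU0, hU, hUδ⟩ := Set.exists_isOpen_lt_of_lt ({0} : Set (EuclideanSpace ℝ (Fin d))) δ
    (μ := volume) (by rw [measure_singleton]; exact pos_iff_ne_zero.2 hδ)
  obtain ⟨ρ, hρ, hρU⟩ := Metric.isOpen_iff.1 hU 0 (hU0 rfl)
  let B : ℕ → Set (EuclideanSpace ℝ (Fin d)) := fun i =>
    Metric.ball (TopologicalSpace.denseSeq _ i) ρ
  have hcover : Metric.closedBall (0 : EuclideanSpace ℝ (Fin d)) r ⊆ ⋃ i, B i := fun x _ => by
    obtain ⟨_, ⟨i, rfl⟩, hxy⟩ := Metric.mem_closure_iff.1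
      (TopologicalSpace.denseRange_denseSeq (EuclideanSpace ℝ (Fin d)) x) ρ hρ
    exact Set.mem_iUnion.2 ⟨i, hxy⟩
  obtain ⟨t, ht⟩ := (isCompact_closedBall _ _).elim_finite_subcover B
    (fun i => Metric.isOpen_ball) hcover
  refine ⟨t.sup id + 1, fun i => disjointed B i ∩ Metric.closedBall 0 r,
    fun i => (MeasurableSet.disjointed (fun i => measurableSet_ball) i).inter
      measurableSet_closedBall,
    fun i j hij => (disjoint_disjointed B hij).mono Set.inter_subset_left Set.inter_subset_left,
    fun i => ?_, ?_⟩
  · calc volume (disjointed B i ∩ Metric.closedBall 0 r) ≤ volume (B i) :=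
          measure_mono (Set.inter_subset_left.trans (disjointed_subset B i))
      _ = volume (Metric.ball (0 : EuclideanSpace ℝ (Fin d)) ρ) :=
          Measure.addHaar_ball_center _ _ _
      _ ≤ δ := (measure_mono hρU).trans hUδ.le
  · rw [← Set.iUnion₂_inter]
    refine Set.inter_eq_right.2 fun x hx => ?_
    obtain ⟨i, hi, hxi⟩ := Set.mem_iUnion₂.1 (ht hx)
    rw [biUnion_range_succ_disjointed]
    exact le_partialSups_of_le B (Finset.le_sup (f := id) hi) hxi

/-! ### The Poincaré inequality -/

theorem poissonMeasure_compl_zero_le (r : NNReal) : poissonMeasure r {n | n ≠ 0} ≤ r := by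
  have h : {n : ℕ | n ≠ 0} = {0}ᶜ := rfl
  rw [h, prob_compl_eq_one_sub (measurableSet_singleton 0), poissonMeasure_singleton,
    ← ENNReal.ofReal_one, ← ENNReal.ofReal_sub _ (by positivity), ← ENNReal.ofReal_coe_nnreal]
  refine ENNReal.ofReal_le_ofReal ?_
  have := Real.add_one_le_exp (-(r : ℝ))
  simp only [pow_zero, Nat.factorial_zero]
  norm_num
  linarith

theorem poissonMeasure_two_le_le (r : NNReal) :
    poissonMeasure r {n | 2 ≤ n} ≤ (r : ENNReal) ^ 2 := by
  have h : {n : ℕ | 2 ≤ n} = ({0} ∪ {1})ᶜ := by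
    ext n
    simp only [Set.mem_ofPred_eq, Set.mem_compl_iff, Set.mem_union, Set.mem_singleton_iff]
    omega
  rw [h, prob_compl_eq_one_sub .of_discrete, measure_union (by simp) .of_discrete,
    poissonMeasure_singleton, poissonMeasure_singleton, ← ENNReal.ofReal_add (by positivity)
    (by positivity), ← ENNReal.ofReal_one, ← ENNReal.ofReal_sub _ (by positivity),
    ← ENNReal.ofReal_coe_nnreal, ← ENNReal.ofReal_pow (by positivity)]
  refine ENNReal.ofReal_le_ofReal ?_
  have := Real.add_one_le_exp (-(r : ℝ))
  simp only [pow_zero, Nat.factorial_zero, Nat.factorial_one, pow_one]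
  norm_num
  nlinarith [r.2, mul_le_mul_of_nonneg_right this (by positivity : 0 ≤ 1 + (r : ℝ))]

namespace HasPoissonLaw

theorem measure_count_ne_zero_le (hX : HasPoissonLaw P X μ) {A : Set (EuclideanSpace ℝ (Fin d))}
    (hA : MeasurableSet A) (hb : Bornology.IsBounded A) :
    P {ω | count A (X ω) ≠ 0} ≤ μ A := by
  have h := poissonMeasure_compl_zero_le (μ A).toNNReal
  have hm : Measurable fun ω => count A (X ω) := (measurable_count hA hb).comp hX.measurable
  rw [← hX.map_count hA hb, Measure.map_apply hm .of_discrete] at h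
  exact h.trans ENNReal.coe_toNNReal_le_self

theorem measure_two_le_count_le (hX : HasPoissonLaw P X μ) {A : Set (EuclideanSpace ℝ (Fin d))}
    (hA : MeasurableSet A) (hb : Bornology.IsBounded A) :
    P {ω | 2 ≤ count A (X ω)} ≤ μ A ^ 2 := by
  have h := poissonMeasure_two_le_le (μ A).toNNReal
  have hm : Measurable fun ω => count A (X ω) := (measurable_count hA hb).comp hX.measurable
  rw [← hX.map_count hA hb, Measure.map_apply hm .of_discrete] at h
  exact h.trans (by gcongr; exact ENNReal.coe_toNNReal_le_self)

theorem resamplingInvariant [IsProbabilityMeasure P] [IsFiniteMeasureOnCompacts μ]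
    (hX : HasPoissonLaw P X μ) : ResamplingInvariant (P.map X) := by
  have := Measure.isProbabilityMeasure_map (μ := P) hX.measurable.aemeasurable
  exact fun A hA => hX.map_id.measurePreserving_glue hA

end HasPoissonLaw

/-- The contribution of one cell. If `C` contains no point of `Y`, the left side vanishes; if it
contains exactly one, emptying `C` is removing that point; otherwise the trivial bound is used. -/
theorem sq_sub_restrict_compl_le (hM : ∀ Y, |S Y| ≤ M) {C : Set (EuclideanSpace ℝ (Fin d))}
    (hb : Bornology.IsBounded C) (Y : PointConfig d) :
    ENNReal.ofReal ((S Y - S (restrict Cᶜ Y)) ^ 2) ≤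
      (∑' x : Y.carrier, C.indicator (fun x => ENNReal.ofReal ((S (Y.remove x) - S Y) ^ 2)) x) +
        (count C ⁻¹' {n | 2 ≤ n}).indicator (fun _ => ENNReal.ofReal ((M + M) ^ 2)) Y := by
  rcases Nat.lt_trichotomy (count C Y) 1 with h | h | h
  · have h0 : restrict Cᶜ Y = Y := by
      have := (count_eq_zero_iff hb Y).1 (by omega)
      ext x
      exact ⟨fun h => h.1, fun h => ⟨h, Set.disjoint_left.1 this h⟩⟩
    simp [h0]
  · obtain ⟨x, hx⟩ := Set.ncard_eq_one.1 h
    have hx' : x ∈ Y.carrier ∩ C := hx ▸ rfl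
    have h0 : restrict Cᶜ Y = Y.remove x := by
      ext y
      change y ∈ Y.carrier ∩ Cᶜ ↔ y ∈ Y.carrier \ {x}
      rw [← hx]
      simp only [Set.mem_inter_iff, Set.mem_compl_iff, Set.mem_sdiff]
      tauto
    refine le_add_right (le_trans ?_ (ENNReal.le_tsum ⟨x, hx'.1⟩))
    rw [Set.indicator_of_mem hx'.2, h0, ← neg_sub, neg_sq]
  · refine le_add_left ?_
    rw [Set.indicator_of_mem (show Y ∈ count C ⁻¹' {n | 2 ≤ n} from h)]
    refine ENNReal.ofReal_le_ofReal ?_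
    rw [← sq_abs]
    exact pow_le_pow_left₀ (abs_nonneg _) ((abs_sub _ _).trans (add_le_add (hM _) (hM _))) 2

theorem sum_tsum_indicator_le_jackknifeSum (S : PointConfig d → ℝ) (Y : PointConfig d)
    {C : ℕ → Set (EuclideanSpace ℝ (Fin d))} (hd : Pairwise (fun i j => Disjoint (C i) (C j)))
    (s : Finset ℕ) :
    ∑ i ∈ s, ∑' x : Y.carrier,
      (C i).indicator (fun x => ENNReal.ofReal ((S (Y.remove x) - S Y) ^ 2)) x ≤
      jackknifeSum S Y := by
  rw [← Summable.tsum_finsetSum fun i _ => ENNReal.summable]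
  refine ENNReal.tsum_le_tsum fun x => ?_
  have := Finset.indicator_biUnion_apply s C (f := fun x => ENNReal.ofReal
    ((S (Y.remove x) - S Y) ^ 2)) (fun i _ j _ hij => hd hij) x
  rw [← this]
  exact Set.indicator_le_self _ _ _

/-- The Poincaré inequality for bounded functionals of a Poisson process. -/
theorem variance_le_lintegral_jackknifeSum (hd : 1 ≤ d) [IsProbabilityMeasure P]
    (hX : HasPoissonLaw P X (ENNReal.ofReal lam • volume)) (hS : Measurable S)
    (hM : ∀ Y, |S Y| ≤ M) :
    ENNReal.ofReal Var[S; P.map X] ≤ ∫⁻ ω, jackknifeSum S (X ω) ∂P := by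
  have : IsFiniteMeasureOnCompacts
      (ENNReal.ofReal lam • (volume : Measure (EuclideanSpace ℝ (Fin d)))) :=
    .smul _ ENNReal.ofReal_ne_top
  have hprob := Measure.isProbabilityMeasure_map (μ := P) hX.measurable.aemeasurable
  have hQ := hX.resamplingInvariant
  refine ENNReal.le_of_forall_pos_le_add fun ε hε _ => ?_
  obtain ⟨n, hn⟩ := exists_predictionError_closedBall_lt hQ hS hM (half_pos (NNReal.coe_pos.2 hε))
  set W : Set (EuclideanSpace ℝ (Fin d)) := Metric.closedBall 0 (n : ℝ) with hW
  set c := ENNReal.ofReal ((M + M) ^ 2)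
  obtain ⟨δ, hδ, hδε⟩ := ENNReal.exists_nnreal_pos_mul_lt
    (a := c * (ENNReal.ofReal lam ^ 2 * volume W)) (b := (ε / 2 : NNReal))
    (ENNReal.mul_ne_top ENNReal.ofReal_ne_top (ENNReal.mul_ne_top (by simp)
      measure_closedBall_lt_top.ne)) (by simpa using hε.ne')
  obtain ⟨N, C, hC, hCd, hCδ, hCW⟩ := exists_partition_closedBall hd (n : ℝ)
    (ENNReal.coe_ne_zero.2 hδ.ne')
  have hCb (i) (hi : i ∈ Finset.range N) : Bornology.IsBounded (C i) :=
    Metric.isBounded_closedBall.subset (hCW ▸ Set.subset_biUnion_of_mem (u := C) hi)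
  have hWm : MeasurableSet W := measurableSet_closedBall
  have hcompl : (⋂ i ∈ Finset.range N, (C i)ᶜ) = Wᶜ := by
    rw [hW, ← hCW, Set.compl_iUnion₂]
  have hvar : Var[S; P.map X] ≤
      ε / 2 + ∑ i ∈ Finset.range N, predictionError (P.map X) (C i)ᶜ S := by
    have h1 := predictionError_inter_le hQ hWm hWm.compl hS hM
    rw [Set.inter_compl_self, predictionError_empty hS, ← hcompl] at h1
    have h2 := predictionError_biInter_le hQ (fun i => (hC i).compl) hS hM (Finset.range N)
    linarith
  have hcell (i) : ENNReal.ofReal (predictionError (P.map X) (C i)ᶜ S) ≤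
      ∫⁻ ω, ENNReal.ofReal ((S (X ω) - S (restrict (C i)ᶜ (X ω))) ^ 2) ∂P := by
    have hm : Measurable fun Y => S (restrict (C i)ᶜ Y) :=
      hS.comp (measurable_restrict (hC i).compl)
    have hsq : Measurable fun Y => (S Y - S (restrict (C i)ᶜ Y)) ^ 2 := (hS.sub hm).pow_const 2
    rw [← lintegral_map hsq.ennreal_ofReal hX.measurable, ← ofReal_integral_eq_lintegral_ofReal]
    · refine ENNReal.ofReal_le_ofReal
        (predictionError_le hQ (hC i).compl hS hM hm (fun Y => hM _) fun Y Z => ?_)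
      simp only [restrict_glue]
    · refine integrable_of_abs_le (M := (M + M) ^ 2) hsq fun Y => ?_
      rw [abs_pow]
      exact pow_le_pow_left₀ (abs_nonneg _) ((abs_sub _ _).trans (add_le_add (hM _) (hM _))) 2
    · exact .of_forall fun Y => sq_nonneg _
  have hms (i) (hi : i ∈ Finset.range N) : MeasurableSet (count (C i) ⁻¹' {n | 2 ≤ n}) :=
    measurable_count (hC i) (hCb i hi) .of_discrete
  have hmi (i) (hi : i ∈ Finset.range N) : Measurable fun ω =>
      (count (C i) ⁻¹' {n | 2 ≤ n}).indicator (fun _ => c) (X ω) :=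
    (measurable_const.indicator (hms i hi)).comp hX.measurable
  have herr : ∑ i ∈ Finset.range N,
      ∫⁻ ω, (count (C i) ⁻¹' {n | 2 ≤ n}).indicator (fun _ => c) (X ω) ∂P ≤ (ε / 2 : NNReal) := by
    calc _ ≤ ∑ i ∈ Finset.range N, c * (ENNReal.ofReal lam ^ 2 * (δ * volume (C i))) := by
          refine Finset.sum_le_sum fun i hi => ?_
          rw [lintegral_map (measurable_const.indicator (hms i hi)) hX.measurable |>.symm,
            lintegral_indicator_const (hms i hi), Measure.map_apply hX.measurable (hms i hi)]
          gcongr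
          refine (hX.measure_two_le_count_le (hC i) (hCb i hi)).trans ?_
          rw [Measure.smul_apply, smul_eq_mul, mul_pow, sq (volume (C i))]
          gcongr
          exact hCδ i
      _ = δ * (c * (ENNReal.ofReal lam ^ 2 * volume W)) := by
          rw [hW, ← hCW, measure_biUnion_finset (fun i _ j _ hij => hCd hij) fun i _ => hC i]
          simp only [Finset.mul_sum]
          exact Finset.sum_congr rfl fun i _ => by ring
      _ ≤ _ := hδε.le
  calc ENNReal.ofReal Var[S; P.map X]
      ≤ ENNReal.ofReal (ε / 2 + ∑ i ∈ Finset.range N, predictionError (P.map X) (C i)ᶜ S) :=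
        ENNReal.ofReal_le_ofReal hvar
    _ ≤ (ε / 2 : NNReal) + ∑ i ∈ Finset.range N,
          ∫⁻ ω, ENNReal.ofReal ((S (X ω) - S (restrict (C i)ᶜ (X ω))) ^ 2) ∂P := by
        have h0 (i) (_ : i ∈ Finset.range N) : 0 ≤ predictionError (P.map X) (C i)ᶜ S :=
          integral_nonneg fun Y => sq_nonneg _
        rw [ENNReal.ofReal_add (by positivity) (Finset.sum_nonneg h0),
          ENNReal.ofReal_sum_of_nonneg h0]
        gcongr with i hi
        · rw [← ENNReal.ofReal_coe_nnreal]
          simp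
        · exact hcell i
    _ = (ε / 2 : NNReal) + ∫⁻ ω, ∑ i ∈ Finset.range N,
          ENNReal.ofReal ((S (X ω) - S (restrict (C i)ᶜ (X ω))) ^ 2) ∂P := by
        rw [lintegral_finsetSum _ fun i _ => ?_]
        exact (((hS.sub (hS.comp (measurable_restrict (hC i).compl))).pow_const
          2).ennreal_ofReal).comp hX.measurable
    _ ≤ (ε / 2 : NNReal) + ∫⁻ ω, (jackknifeSum S (X ω) + ∑ i ∈ Finset.range N,
          (count (C i) ⁻¹' {n | 2 ≤ n}).indicator (fun _ => c) (X ω)) ∂P := by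
        gcongr with ω
        refine (Finset.sum_le_sum fun i hi =>
          sq_sub_restrict_compl_le hM (hCb i hi) (X ω)).trans ?_
        rw [Finset.sum_add_distrib]
        gcongr
        exact sum_tsum_indicator_le_jackknifeSum S (X ω) hCd _
    _ ≤ (ε / 2 : NNReal) + (∫⁻ ω, jackknifeSum S (X ω) ∂P + (ε / 2 : NNReal)) := by
        rw [lintegral_add_right _ (Finset.measurable_sum _ hmi), lintegral_finsetSum _ hmi]
        gcongr
    _ = ∫⁻ ω, jackknifeSum S (X ω) ∂P + ε := by
        rw [add_left_comm, ← ENNReal.coe_add, add_halves]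

end

section

open PointConfig

variable {d : ℕ} {α β : Type*} [MeasurableSpace α] [MeasurableSpace β]
  {P : Measure α} {P' : Measure β} {X : α → PointConfig d} {X' : β → PointConfig d}
  {lam κ : ℝ} {S : PointConfig d → ℝ} {M : ℝ}

/-! ### The union of two independent Poisson processes -/

namespace HasPoissonLaw

/-- Two independent Poisson processes almost surely have no common point. -/
theorem ae_disjoint (hd : 1 ≤ d) [IsProbabilityMeasure P] [IsProbabilityMeasure P']
    (hX : HasPoissonLaw P X (ENNReal.ofReal lam • volume))
    (hX' : HasPoissonLaw P' X' (ENNReal.ofReal κ • volume)) :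
    ∀ᵐ p ∂P.prod P', Disjoint (X p.1).carrier (X' p.2).carrier := by
  have key (n : ℕ) : ∀ᵐ p ∂P.prod P',
      Disjoint ((X p.1).carrier ∩ Metric.closedBall 0 (n : ℝ)) (X' p.2).carrier := by
    rw [ae_iff, ← nonpos_iff_eq_zero]
    refine ENNReal.le_of_forall_pos_le_add fun ε hε _ => ?_
    set W : Set (EuclideanSpace ℝ (Fin d)) := Metric.closedBall 0 (n : ℝ) with hW
    obtain ⟨δ, hδ, hδε⟩ := ENNReal.exists_nnreal_pos_mul_lt
      (a := ENNReal.ofReal lam * ENNReal.ofReal κ * volume W) (b := ε)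
      (ENNReal.mul_ne_top (by finiteness) measure_closedBall_lt_top.ne) (by simpa using hε.ne')
    obtain ⟨N, C, hC, hCd, hCδ, hCW⟩ := exists_partition_closedBall hd (n : ℝ)
      (ENNReal.coe_ne_zero.2 hδ.ne')
    have hCb (i) (hi : i ∈ Finset.range N) : Bornology.IsBounded (C i) :=
      Metric.isBounded_closedBall.subset (hCW ▸ Set.subset_biUnion_of_mem (u := C) hi)
    have hsub : {p : α × β | ¬Disjoint ((X p.1).carrier ∩ W) (X' p.2).carrier} ⊆
        ⋃ i ∈ Finset.range N, {ω | count (C i) (X ω) ≠ 0} ×ˢ {ω | count (C i) (X' ω) ≠ 0} := by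
      intro p hp
      obtain ⟨x, ⟨hx, hxW⟩, hx'⟩ := Set.not_disjoint_iff.1 hp
      rw [hW, ← hCW] at hxW
      obtain ⟨i, hi, hxi⟩ := Set.mem_iUnion₂.1 hxW
      refine Set.mem_iUnion₂.2 ⟨i, hi, fun h => ?_, fun h => ?_⟩
      · exact Set.disjoint_left.1 ((count_eq_zero_iff (hCb i hi) _).1 h) hx hxi
      · exact Set.disjoint_left.1 ((count_eq_zero_iff (hCb i hi) _).1 h) hx' hxi
    calc _ ≤ ∑ i ∈ Finset.range N, P {ω | count (C i) (X ω) ≠ 0} *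
          P' {ω | count (C i) (X' ω) ≠ 0} := by
          refine (measure_mono hsub).trans ((measure_biUnion_finset_le _ _).trans_eq ?_)
          simp only [Measure.prod_prod]
      _ ≤ ∑ i ∈ Finset.range N,
          (ENNReal.ofReal lam * δ) * (ENNReal.ofReal κ * volume (C i)) := by
          refine Finset.sum_le_sum fun i hi => mul_le_mul' ?_ ?_
          · refine (hX.measure_count_ne_zero_le (hC i) (hCb i hi)).trans ?_
            rw [Measure.smul_apply, smul_eq_mul]
            gcongr
            exact hCδ i
          · exact hX'.measure_count_ne_zero_le (hC i) (hCb i hi)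
      _ = δ * (ENNReal.ofReal lam * ENNReal.ofReal κ * volume W) := by
          rw [hW, ← hCW, measure_biUnion_finset (fun i _ j _ hij => hCd hij) fun i _ => hC i]
          simp only [Finset.mul_sum]
          exact Finset.sum_congr rfl fun i _ => by ring
      _ ≤ 0 + ε := by rw [zero_add]; exact hδε.le
  filter_upwards [ae_all_iff.2 key] with p hp
  refine Set.disjoint_left.2 fun x hx hx' => ?_
  obtain ⟨n, hn⟩ := exists_nat_ge ‖x‖
  exact Set.disjoint_left.1 (hp n) ⟨hx, mem_closedBall_zero_iff.2 hn⟩ hx'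

/-- The union of two independent Poisson processes is a Poisson process, the intensities being
added. The union is redefined on a null set containing the event that the two processes share a
point: off this set the counts add up, which makes the modified union measurable. -/
theorem exists_union (hd : 1 ≤ d) [IsProbabilityMeasure P] [IsProbabilityMeasure P']
    (hlam : 0 ≤ lam) (hκ : 0 ≤ κ)
    (hX : HasPoissonLaw P X (ENNReal.ofReal lam • volume))
    (hX' : HasPoissonLaw P' X' (ENNReal.ofReal κ • volume)) :
    ∃ Z : α × β → PointConfig d, (∀ᵐ p ∂P.prod P', Z p = X p.1 ∪ X' p.2) ∧
      HasPoissonLaw (P.prod P') Z (ENNReal.ofReal (lam + κ) • volume) := by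
  classical
  set N := toMeasurable (P.prod P') {p | ¬Disjoint (X p.1).carrier (X' p.2).carrier}
  have hNm : MeasurableSet N := measurableSet_toMeasurable _ _
  have hN0 : ∀ᵐ p ∂P.prod P', p ∉ N := by
    rw [ae_iff]
    simp only [not_not]
    exact (measure_toMeasurable _).trans (ae_iff.1 (ae_disjoint hd hX hX'))
  have hdisj (p) (hp : p ∉ N) : Disjoint (X p.1).carrier (X' p.2).carrier := by
    by_contra h
    exact hp (subset_toMeasurable _ _ h)
  let Z : α × β → PointConfig d := fun p => if p ∈ N then X p.1 else X p.1 ∪ X' p.2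
  have hcount (A : Set (EuclideanSpace ℝ (Fin d))) (hb : Bornology.IsBounded A) (p) :
      count A (Z p) =
        if p ∈ N then count A (X p.1) else count A (X p.1) + count A (X' p.2) := by
    by_cases hp : p ∈ N
    · simp only [Z, if_pos hp]
    · simp only [Z, if_neg hp]
      exact count_union_of_disjoint hb (hdisj p hp)
  have hZ : Measurable Z := by
    refine measurable_of_count fun A hA hb => ?_
    simp only [hcount A hb]
    have h1 : Measurable fun p : α × β => count A (X p.1) :=
      (measurable_count hA hb).comp (hX.measurable.comp measurable_fst)
    have h2 : Measurable fun p : α × β => count A (X' p.2) :=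
      (measurable_count hA hb).comp (hX'.measurable.comp measurable_snd)
    exact Measurable.ite hNm h1 (h1.add h2)
  refine ⟨Z, ?_, ?_⟩
  · filter_upwards [hN0] with p hp
    simp only [Z, if_neg hp]
  · have f1 : IsFiniteMeasureOnCompacts
        (ENNReal.ofReal lam • (volume : Measure (EuclideanSpace ℝ (Fin d)))) :=
      .smul _ ENNReal.ofReal_ne_top
    have f2 : IsFiniteMeasureOnCompacts
        (ENNReal.ofReal κ • (volume : Measure (EuclideanSpace ℝ (Fin d)))) :=
      .smul _ ENNReal.ofReal_ne_top
    rw [ENNReal.ofReal_add hlam hκ, add_smul]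
    refine superposition hX hX' hZ fun A _ hb => ?_
    filter_upwards [hN0] with p hp
    rw [hcount A hb, if_neg hp]

end HasPoissonLaw

/-! ### Adding a sparse Poisson process -/

/-- A finite radius of influence makes a functional continuous in law under the addition of a
Poisson process of vanishing intensity. The sparse process is a dilated independent copy of `X`. -/
theorem tendsto_integral_of_radius (hd : 1 ≤ d) (hlam : 0 ≤ lam) [IsProbabilityMeasure P]
    (hX : HasPoissonLaw P X (ENNReal.ofReal lam • volume)) {Ω' : ℕ → Type*}
    [∀ m, MeasurableSpace (Ω' m)] (P' : ∀ m, Measure (Ω' m)) [∀ m, IsProbabilityMeasure (P' m)]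
    (X' : ∀ m, Ω' m → PointConfig d)
    (hX' : ∀ m : ℕ, 1 ≤ m →
      HasPoissonLaw (P' m) (X' m) (ENNReal.ofReal (lam * (1 + 1 / (m : ℝ))) • volume))
    (hS : Measurable S) (hM : ∀ Y, |S Y| ≤ M)
    (hR : ∀ᵐ ω ∂P, ∃ r : ℝ, ∀ D : PointConfig d, D.carrier ⊆ (Metric.closedBall 0 r)ᶜ →
      S (X ω) = S (X ω ∪ D)) :
    Tendsto (fun m => ∫ Y, S Y ∂(P' m).map (X' m)) atTop (nhds (∫ Y, S Y ∂P.map X)) := by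
  -- shifting the index by one keeps the dilation factors positive
  rw [← tendsto_add_atTop_iff_nat 1]
  let c : ℕ → ℝ := fun m => ((m + 1 : ℕ) : ℝ) ^ ((d : ℝ)⁻¹)
  have hc (m) : 0 < c m := by positivity
  have hcd (m) : c m ^ d = ((m + 1 : ℕ) : ℝ) := Real.rpow_inv_natCast_pow (by positivity) (by omega)
  let D : ℕ → α → PointConfig d := fun m ω => dilate (c m) (hc m).ne' (X ω)
  have hD (m) : HasPoissonLaw P (D m) (ENNReal.ofReal (lam / ((m + 1 : ℕ) : ℝ)) • volume) := by
    have := hX.dilate (hc m)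
    rwa [hcd] at this
  choose Z hZu hZ using fun m => HasPoissonLaw.exists_union hd hlam (by positivity) hX (hD m)
  have hint (m) : ∫ Y, S Y ∂(P' (m + 1)).map (X' (m + 1)) =
      ∫ ω, ∫ ω', S (Z m (ω, ω')) ∂P ∂P := by
    have h : lam + lam / ((m + 1 : ℕ) : ℝ) = lam * (1 + 1 / ((m + 1 : ℕ) : ℝ)) := by ring
    have hZm := hZ m
    rw [h] at hZm
    rw [(hX' (m + 1) (by omega)).map_eq hZm, integral_map hZm.measurable.aemeasurable
      hS.aestronglyMeasurable]
    exact integral_prod _ (integrable_of_abs_le (hS.comp hZm.measurable) fun p => hM _)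
  simp only [hint]
  rw [integral_map hX.measurable.aemeasurable hS.aestronglyMeasurable]
  have hSZ (m) : Measurable fun p => S (Z m p) := hS.comp (hZ m).measurable
  refine tendsto_integral_of_dominated_convergence (fun _ => M)
    (fun m => ((hSZ m).stronglyMeasurable.integral_prod_right').aestronglyMeasurable)
    (integrable_const _) (fun m => .of_forall fun ω => ?_) ?_
  · simpa using norm_integral_le_of_norm_le_const (μ := P)
      (.of_forall fun ω' => (Real.norm_eq_abs _).trans_le (hM (Z m (ω, ω'))))
  filter_upwards [hR, ae_all_iff.2 fun m => Measure.ae_ae_of_ae_prod (hZu m)] with ω ⟨r, hr⟩ hω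
  set K : Set (EuclideanSpace ℝ (Fin d)) := Metric.closedBall 0 r
  have hKm : MeasurableSet K := measurableSet_closedBall
  have hKb : Bornology.IsBounded K := Metric.isBounded_closedBall
  have hM0 : 0 ≤ M := (abs_nonneg _).trans (hM (X ω))
  have hms (m) : MeasurableSet {ω' | count K (D m ω') ≠ 0} :=
    ((measurable_count hKm hKb).comp (hD m).measurable)
      (MeasurableSet.of_discrete (s := {n : ℕ | n ≠ 0}))
  have hSω (m) : Measurable fun ω' => S (Z m (ω, ω')) := (hSZ m).comp measurable_prodMk_left
  have hbound (m) : ‖(∫ ω', S (Z m (ω, ω')) ∂P) - S (X ω)‖ ≤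
      (M + M) * (lam / ((m + 1 : ℕ) : ℝ) * volume.real K) := by
    have h0 : (∫ ω', S (Z m (ω, ω')) ∂P) - S (X ω) = ∫ ω', (S (Z m (ω, ω')) - S (X ω)) ∂P := by
      rw [integral_sub (integrable_of_abs_le (hSω m) fun ω' => hM _) (integrable_const _)]
      simp
    have h1 : ‖∫ ω', (S (Z m (ω, ω')) - S (X ω)) ∂P‖ ≤
        ∫ ω', {ω' | count K (D m ω') ≠ 0}.indicator (fun _ => M + M) ω' ∂P := by
      refine norm_integral_le_of_norm_le ((integrable_const _).indicator (hms m)) ?_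
      filter_upwards [hω m] with ω' hω'
      by_cases hk : count K (D m ω') = 0
      · have h2 : (D m ω').carrier ⊆ Kᶜ :=
          Set.subset_compl_iff_disjoint_right.2 ((count_eq_zero_iff hKb _).1 hk)
        rw [hω', ← hr _ h2, sub_self, norm_zero]
        exact Set.indicator_nonneg (fun _ _ => by linarith) _
      · rw [Set.indicator_of_mem (show ω' ∈ {ω' | count K (D m ω') ≠ 0} from hk)]
        exact (abs_sub _ _).trans (add_le_add (hM _) (hM _))
    rw [h0]
    refine h1.trans ?_
    rw [integral_indicator_const _ (hms m), smul_eq_mul, mul_comm]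
    gcongr
    have h3 := (hD m).measure_count_ne_zero_le hKm hKb
    rw [Measure.smul_apply, smul_eq_mul] at h3
    have h4 := ENNReal.toReal_mono (ENNReal.mul_ne_top ENNReal.ofReal_ne_top
      hKb.measure_lt_top.ne) h3
    rwa [ENNReal.toReal_mul, ENNReal.toReal_ofReal (by positivity)] at h4
  rw [tendsto_iff_norm_sub_tendsto_zero]
  refine squeeze_zero (fun m => norm_nonneg _) hbound ?_
  have h5 : Tendsto (fun m : ℕ => lam / ((m + 1 : ℕ) : ℝ)) atTop (nhds 0) :=
    (tendsto_const_div_atTop_nhds_zero_nat lam).comp (tendsto_add_atTop_nat 1)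
  simpa using (h5.mul_const (volume.real K)).const_mul (M + M)

/-! ### Variance and truncation -/

/-- The variance as half the mean square difference of two independent copies. -/
theorem lintegral_prod_sq_sub {Z : α → ℝ} [IsProbabilityMeasure P] (hZ : MemLp Z 2 P) :
    ∫⁻ p, ENNReal.ofReal ((Z p.1 - Z p.2) ^ 2) ∂P.prod P = 2 * evariance Z P := by
  have h1 : Var[fun p : α × α => Z p.1 + (-Z) p.2; P.prod P] = Var[Z; P] + Var[-Z; P] :=
    variance_add_prod hZ hZ.neg
  have hm : MemLp (fun p : α × α => Z p.1 - Z p.2) 2 (P.prod P) :=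
    (hZ.comp_measurePreserving measurePreserving_fst).sub
      (hZ.comp_measurePreserving measurePreserving_snd)
  have hi := hZ.integrable one_le_two
  have h0 : ∫ p, (Z p.1 - Z p.2) ∂P.prod P = 0 := by
    rw [integral_sub (hi.comp_fst P) (hi.comp_snd P), integral_fun_fst, integral_fun_snd]
    simp
  rw [← ofReal_integral_eq_lintegral_ofReal hm.integrable_sq (.of_forall fun p => sq_nonneg _),
    ← variance_of_integral_eq_zero hm.aestronglyMeasurable.aemeasurable h0]
  simp only [Pi.neg_apply, ← sub_eq_add_neg, variance_neg] at h1
  rw [h1, ENNReal.ofReal_add (variance_nonneg _ _) (variance_nonneg _ _), ofReal_variance hZ,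
    two_mul]

/-- The truncation of a real number to the interval `[-n, n]`. -/
def truncate (n : ℕ) (x : ℝ) : ℝ := max (-n) (min n x)

theorem measurable_truncate (n : ℕ) : Measurable (truncate n) := by
  unfold truncate
  fun_prop

theorem abs_truncate_le (n : ℕ) (x : ℝ) : |truncate n x| ≤ n :=
  abs_le.2 ⟨le_max_left _ _, max_le (by linarith [n.cast_nonneg (α := ℝ)]) (min_le_left _ _)⟩

theorem truncate_of_abs_le {n : ℕ} {x : ℝ} (h : |x| ≤ n) : truncate n x = x := by
  rw [truncate, min_eq_right (abs_le.1 h).2, max_eq_right (abs_le.1 h).1]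

theorem sq_truncate_sub_le (n : ℕ) (x y : ℝ) :
    (truncate n x - truncate n y) ^ 2 ≤ (x - y) ^ 2 := by
  rw [sq_le_sq]
  calc |truncate n x - truncate n y| ≤ |min (n : ℝ) x - min (n : ℝ) y| := by
        simpa [truncate] using abs_max_sub_max_le_max (-(n : ℝ)) (min n x) (-n) (min n y)
    _ ≤ |x - y| := by simpa using abs_min_sub_min_le_max (n : ℝ) x n y

/-- The variance is lower semicontinuous along truncations. If all of them have variance at most
`C < ∞`, then the variable is square integrable by Fatou's lemma for two independent copies. -/
theorem evariance_le_of_truncate [IsProbabilityMeasure P] {Z : α → ℝ} (hZ : Measurable Z)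
    {C : ENNReal} (h : ∀ n : ℕ, evariance (fun ω => truncate n (Z ω)) P ≤ C) :
    evariance Z P ≤ C := by
  rcases eq_or_ne C ⊤ with rfl | hC
  · exact le_top
  have hT (n : ℕ) : Measurable fun ω => truncate n (Z ω) := (measurable_truncate n).comp hZ
  have hm (n : ℕ) : Measurable fun p : α × α =>
      ENNReal.ofReal ((truncate n (Z p.1) - truncate n (Z p.2)) ^ 2) :=
    ((((hT n).comp measurable_fst).sub ((hT n).comp measurable_snd)).pow_const 2).ennreal_ofReal
  have hfatou : ∫⁻ p, ENNReal.ofReal ((Z p.1 - Z p.2) ^ 2) ∂P.prod P ≤ 2 * C := by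
    calc ∫⁻ p, ENNReal.ofReal ((Z p.1 - Z p.2) ^ 2) ∂P.prod P
        = ∫⁻ p, liminf (fun n => ENNReal.ofReal
            ((truncate n (Z p.1) - truncate n (Z p.2)) ^ 2)) atTop ∂P.prod P := by
          refine lintegral_congr fun p => (Tendsto.liminf_eq (tendsto_const_nhds.congr' ?_)).symm
          filter_upwards [tendsto_natCast_atTop_atTop.eventually_ge_atTop |Z p.1|,
            tendsto_natCast_atTop_atTop.eventually_ge_atTop |Z p.2|] with n h1 h2
          rw [truncate_of_abs_le h1, truncate_of_abs_le h2]
      _ ≤ liminf (fun n => ∫⁻ p, ENNReal.ofReal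
            ((truncate n (Z p.1) - truncate n (Z p.2)) ^ 2) ∂P.prod P) atTop :=
          lintegral_liminf_le hm
      _ ≤ 2 * C := by
          refine liminf_le_of_le (by isBoundedDefault) fun b hb => ?_
          obtain ⟨n, hn⟩ := hb.exists
          refine hn.trans ?_
          rw [lintegral_prod_sq_sub (.of_bound (hT n).aestronglyMeasurable n
            (.of_forall fun ω => abs_truncate_le n _))]
          gcongr
          exact h n
  have hmZ : Measurable fun p : α × α => ENNReal.ofReal ((Z p.1 - Z p.2) ^ 2) :=
    (((hZ.comp measurable_fst).sub (hZ.comp measurable_snd)).pow_const 2).ennreal_ofReal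
  have hL : MemLp Z 2 P := by
    have hlt := hfatou.trans_lt (ENNReal.mul_lt_top (by simp) hC.lt_top)
    rw [lintegral_prod _ hmZ.aemeasurable] at hlt
    obtain ⟨ω, hω⟩ := (ae_lt_top hmZ.lintegral_prod_right' hlt.ne).exists
    have hd : Measurable fun ω' => Z ω - Z ω' := measurable_const.sub hZ
    have h2 : MemLp (fun ω' => Z ω - Z ω') 2 P := by
      rw [memLp_two_iff_integrable_sq hd.aestronglyMeasurable]
      refine ⟨(hd.pow_const 2).aestronglyMeasurable, ?_⟩
      rw [hasFiniteIntegral_iff_ofReal (.of_forall fun _ => sq_nonneg _)]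
      exact hω
    have h3 : Z = (fun _ => Z ω) - fun ω' => Z ω - Z ω' := by ext; simp
    rw [h3]
    exact (memLp_const (Z ω)).sub h2
  rw [lintegral_prod_sq_sub hL] at hfatou
  exact (ENNReal.mul_le_mul_iff_right (by simp) (by simp)).1 hfatou

theorem jackknifeSum_truncate_le (n : ℕ) (S : PointConfig d → ℝ) (Y : PointConfig d) :
    jackknifeSum (fun Y => truncate n (S Y)) Y ≤ jackknifeSum S Y :=
  ENNReal.tsum_le_tsum fun _ => ENNReal.ofReal_le_ofReal (sq_truncate_sub_le n _ _)

end

/-! ### The variance bound -/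

theorem theorem4 {d : ℕ} (hd : 1 ≤ d) (lam : ℝ) (hlam : 0 < lam)
    {Ω : Type*} [MeasurableSpace Ω] (P : Measure Ω) [IsProbabilityMeasure P]
    (X : Ω → PointConfig d) (hX : IsPoissonProcess P X lam)
    {Ω' : ℕ → Type*} [∀ m, MeasurableSpace (Ω' m)] (P' : ∀ m, Measure (Ω' m))
    [∀ m, IsProbabilityMeasure (P' m)]
    (X' : ∀ m, Ω' m → PointConfig d)
    (hX' : ∀ m : ℕ, 1 ≤ m → IsPoissonProcess (P' m) (X' m) (lam * (1 + 1 / (m : ℝ))))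
    (S : PointConfig d → ℝ) (hS : Measurable S)
    (f : ℝ → ℝ) (R : PointConfig d → ℝ)
    (hR : ∀ᵐ ω ∂P, IsRadiusOfInfluence S f (X ω) (R (X ω)))
    (hint : Integrable (fun ω => f (R (X ω)) ^ 2 * R (X ω) ^ (2 * d)) P) :
    evariance (fun ω => S (X ω)) P ≤
      liminf (fun m : ℕ => ∫⁻ ω, jackknifeSum S (X' m ω) ∂(P' m)) atTop := by
  have hXp := hX.hasPoissonLaw hlam.le
  have hXp' (m : ℕ) (hm : 1 ≤ m) := (hX' m hm).hasPoissonLaw (by positivity)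
  refine evariance_le_of_truncate (hS.comp hX.measurable) fun n => ?_
  set T : PointConfig d → ℝ := fun Y => truncate n (S Y)
  have hT : Measurable T := (measurable_truncate n).comp hS
  have hTn (Y) : |T Y| ≤ n := abs_truncate_le n _
  have hTn2 (Y) : |T Y ^ 2| ≤ (n : ℝ) ^ 2 := by
    rw [abs_pow]
    exact pow_le_pow_left₀ (abs_nonneg _) (hTn Y) 2
  have hrad : ∀ᵐ ω ∂P, ∃ r : ℝ, ∀ D : PointConfig d, D.carrier ⊆ (Metric.closedBall 0 r)ᶜ →
      T (X ω) = T (X ω ∪ D) := by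
    filter_upwards [hR] with ω hω
    refine ⟨|R (X ω)|, fun D hD => congrArg (truncate n) (hω.1 D (hD.trans ?_))⟩
    rw [Set.compl_subset_compl]
    rintro _ ⟨x, hx, rfl⟩
    simp only [mem_closedBall_zero_iff, norm_smul, Real.norm_eq_abs] at hx ⊢
    exact mul_le_of_le_one_right (abs_nonneg _) hx
  have hvar (Q : Measure (PointConfig d)) [IsProbabilityMeasure Q] :
      Var[T; Q] = ∫ Y, T Y ^ 2 ∂Q - (∫ Y, T Y ∂Q) ^ 2 :=
    variance_eq_sub (.of_bound hT.aestronglyMeasurable n (.of_forall hTn))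
  have hlim : Tendsto (fun m => Var[T; (P' m).map (X' m)]) atTop (nhds Var[T; P.map X]) := by
    have := Measure.isProbabilityMeasure_map (μ := P) hX.measurable.aemeasurable
    rw [hvar]
    have h1 := tendsto_integral_of_radius hd hlam.le hXp P' X' hXp' hT hTn hrad
    have h2 := tendsto_integral_of_radius hd hlam.le hXp P' X' hXp' (hT.pow_const 2) hTn2
      (hrad.mono fun ω ⟨r, hr⟩ => ⟨r, fun D hD => by rw [hr D hD]⟩)
    refine (h2.sub (h1.pow 2)).congr' ?_
    filter_upwards [eventually_ge_atTop 1] with m hm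
    have := Measure.isProbabilityMeasure_map (μ := P' m) (hX' m hm).measurable.aemeasurable
    rw [hvar]
  have hev : evariance (fun ω => T (X ω)) P = ENNReal.ofReal Var[T; P.map X] := by
    rw [variance_map hT.aemeasurable hX.measurable.aemeasurable]
    exact (ofReal_variance (.of_bound (hT.comp hX.measurable).aestronglyMeasurable n
      (.of_forall fun ω => hTn _))).symm
  change evariance (fun ω => T (X ω)) P ≤ _
  rw [hev, ← (ENNReal.tendsto_ofReal hlim).liminf_eq]
  refine liminf_le_liminf ?_
  filter_upwards [eventually_ge_atTop 1] with m hm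
  exact (variance_le_lintegral_jackknifeSum hd (hXp' m hm) hT hTn).trans
    (lintegral_mono fun ω => jackknifeSum_truncate_le n S _)
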